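/- Let $X$ be an infinite-dimensional real or complex Banach space and $T$ a bounded linear operator on $X$. A bounded linear operator $S$ on a Banach space $Y$ is called *hypercyclic* (respectively *weakly hypercyclic*, *convex-cyclic*, *cyclic*) if there is a vector $y \in Y$ with orbit $\mathrm{Orb}(S,y) = \{S^n y : n = 0,1,2,\dots\}$ such that $\mathrm{Orb}(S,y)$ is dense in the norm topology (respectively $\mathrm{Orb}(S,y)$ is dense in the weak topology, the convex hull of $\mathrm{Orb}(S,y)$ is norm dense, the linear span of $\mathrm{Orb}(S,y)$ is norm dense) in $Y$. For bounded operators $A,B$ on $X$, let $A\oplus B$ be the operator $(u,v)\mapsto (Au,Bv)$ on $X\oplus X$. Suppose that $T$ is hypercyclic and that $T\oplus T$ is not hypercyclic. Then $T\oplus(-T)$ is convex-cyclic but not weakly hypercyclic, and $(T\oplus(-T))^2$ is not cyclic. -/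

import Mathlib

namespace LinearDynamics

variable {𝕜 : Type*} [RCLike 𝕜] {X : Type*} [NormedAddCommGroup X] [NormedSpace 𝕜 X]

/-- The orbit `{T ^ n x : n = 0, 1, 2, …}` of the vector `x` under the operator `T`. -/
def orbit (T : X →L[𝕜] X) (x : X) : Set X :=
  Set.range fun n : ℕ => (T ^ n) x

/-- `T` is cyclic: for some `x` the linear span of the orbit of `x` is norm dense. -/
def IsCyclic (T : X →L[𝕜] X) : Prop :=
  ∃ x : X, Dense (Submodule.span 𝕜 (orbit T x) : Set X)

/-- `T` is hypercyclic: some orbit is norm dense. -/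
def IsHypercyclic (T : X →L[𝕜] X) : Prop :=
  ∃ x : X, Dense (orbit T x)

/-- `T` is weakly hypercyclic: some orbit is dense for the weak topology of `X`. -/
def IsWeaklyHypercyclic (T : X →L[𝕜] X) : Prop :=
  ∃ x : X, Dense (toWeakSpace 𝕜 X '' orbit T x)

/-- The convex hull (convex combinations with real coefficients) of a subset of a real or complex
space, `X` being regarded as a real space by restriction of scalars along `ℝ → 𝕜`. -/
def realConvexHull (𝕜 : Type*) [RCLike 𝕜] {X : Type*} [NormedAddCommGroup X] [NormedSpace 𝕜 X]
    (s : Set X) : Set X :=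
  letI : NormedSpace ℝ X := NormedSpace.restrictScalars ℝ 𝕜 X
  convexHull ℝ s

/-- `T` is convex-cyclic: for some `x` the convex hull of the orbit of `x` is norm dense. -/
def IsConvexCyclic (T : X →L[𝕜] X) : Prop :=
  ∃ x : X, Dense (realConvexHull 𝕜 (orbit T x))

end LinearDynamics

namespace LinearDynamics

open Polynomial Set

/-! Both negative claims reduce to: if `T` is hypercyclic and `T ⊕ T` is cyclic, then `T ⊕ T` is
hypercyclic. Indeed `(T ⊕ -T)² = (T ⊕ T)²`, and weak hypercyclicity of an operator makes its square
cyclic (`IsWeaklyHypercyclic.isCyclic_sq`). The reduction rests on nonzero polynomials in `T` having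
dense range, which turns cyclicity into transitivity. Convex-cyclicity is Hahn–Banach: a separating
functional would be bounded above on the orbit of `(x, x)`, giving a nonzero functional bounded
above on the even iterates of `x` or of `T x`. `exists_lt_apply_pow_even` forbids this. -/

theorem exists_Ioo_forall_pow_notMem {r : ℝ} (hr : 0 ≤ r) {a : ℝ} (ha : 0 ≤ a) :
    ∃ u v : ℝ, 0 < u ∧ u < v ∧ ∀ n : ℕ, r ^ n * a ∉ Ioo u v := by
  by_cases h : r ≤ 1 ∨ a = 0
  · refine ⟨a + 1, a + 2, by positivity, by linarith, fun n hn => ?_⟩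
    have : r ^ n * a ≤ a := by
      rcases h with h | rfl
      · exact mul_le_of_le_one_left ha (pow_le_one₀ hr h)
      · simp
    linarith [hn.1]
  · push Not at h
    have ha' : 0 < a := lt_of_le_of_ne ha (Ne.symm h.2)
    refine ⟨a / 2, a, by positivity, by linarith, fun n hn => ?_⟩
    have : a ≤ r ^ n * a := le_mul_of_one_le_left ha (one_le_pow₀ h.1.le)
    linarith [hn.2]

/-! ### Polynomials in a hypercyclic operator. -/

section Polynomials

variable {𝕜 : Type*} [RCLike 𝕜] {X : Type*} [NormedAddCommGroup X] [NormedSpace 𝕜 X]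

theorem aeval_mem_span_orbit (T : X →L[𝕜] X) (x : X) (q : 𝕜[X]) :
    aeval T q x ∈ Submodule.span 𝕜 (orbit T x) := by
  induction q using Polynomial.induction_on' with
  | add p q hp hq => simpa using add_mem hp hq
  | monomial n a =>
    rw [aeval_monomial, Algebra.algebraMap_eq_smul_one, smul_mul_assoc, one_mul]
    exact Submodule.smul_mem _ _ (Submodule.subset_span ⟨n, rfl⟩)

theorem mem_span_orbit_iff (T : X →L[𝕜] X) (x y : X) :
    y ∈ Submodule.span 𝕜 (orbit T x) ↔ ∃ q : 𝕜[X], aeval T q x = y := by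
  refine ⟨fun hy => ?_, by rintro ⟨q, rfl⟩; exact aeval_mem_span_orbit T x q⟩
  induction hy using Submodule.span_induction with
  | mem y hy =>
    obtain ⟨n, rfl⟩ := hy
    exact ⟨Polynomial.X ^ n, by simp⟩
  | zero => exact ⟨0, by simp⟩
  | add y z _ _ hy hz =>
    obtain ⟨p, rfl⟩ := hy
    obtain ⟨q, rfl⟩ := hz
    exact ⟨p + q, by simp⟩
  | smul c y _ hy =>
    obtain ⟨p, rfl⟩ := hy
    exact ⟨c • p, by simp⟩

theorem aeval_comm_apply (T : X →L[𝕜] X) (p q : 𝕜[X]) (x : X) :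
    aeval T p (aeval T q x) = aeval T q (aeval T p x) := by
  rw [← mul_apply_eq_comp, ← mul_apply_eq_comp, ← map_mul, ← map_mul,
    mul_comm]

theorem aeval_prodMap_self (T : X →L[𝕜] X) (q : 𝕜[X]) (u v : X) :
    aeval (T.prodMap T) q (u, v) = (aeval T q u, aeval T q v) := by
  have pow : ∀ n : ℕ, ((T.prodMap T) ^ n) (u, v) = ((T ^ n) u, (T ^ n) v) := fun n => by
    induction n with
    | zero => rfl
    | succ n ih => simp [pow_succ', ih]
  induction q using Polynomial.induction_on' with
  | add p q hp hq => simp [hp, hq]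
  | monomial n a =>
    simp only [aeval_monomial, Algebra.algebraMap_eq_smul_one, smul_mul_assoc, one_mul,
      smul_apply, pow, Prod.smul_mk]

/-- A linear map on a nonzero finite-dimensional space has no dense orbit. -/
theorem not_dense_range_pow_apply_of_finiteDimensional {V : Type*} [NormedAddCommGroup V]
    [NormedSpace 𝕜 V] [FiniteDimensional 𝕜 V] [Nontrivial V] (A : V →ₗ[𝕜] V) (x : V) :
    ¬ Dense (range fun n : ℕ => (A ^ n) x) := by
  intro hd
  let ev : 𝕜[X] →ₗ[𝕜] V := (LinearMap.applyₗ x).comp (aeval A).toLinearMap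
  have hev : ∀ q, ev q = aeval A q x := fun q => rfl
  have hsurj : LinearMap.range ev = ⊤ := by
    rw [← Submodule.dense_iff_topologicalClosure_eq_top.mp
      (hd.mono (s₂ := (LinearMap.range ev : Set V)) ?_)]
    · exact (Submodule.closed_of_finiteDimensional _).submodule_topologicalClosure_eq.symm
    · rintro _ ⟨n, rfl⟩
      exact ⟨Polynomial.X ^ n, by simp [hev]⟩
  obtain ⟨s, hs⟩ := ev.exists_rightInverse_of_surjective hsurj
  replace hs : ∀ y, aeval A (s y) x = y := fun y => LinearMap.congr_fun hs y
  -- As `x` is cyclic, an operator in the commutative algebra `𝕜[A]` is determined by its value at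
  -- `x`. So `Φ y`, the element of `𝕜[A]` sending `x` to `y`, is linear in `y`, and `‖det (Φ y)‖` is
  -- continuous. It runs through powers of `‖det A‖` on the orbit, but takes every nonnegative value
  -- on `𝕜 x`.
  have huniq : ∀ p q : 𝕜[X], aeval A p x = aeval A q x → aeval A p = aeval A q := by
    intro p q h
    ext y
    have key : ∀ r : 𝕜[X], aeval A r y = aeval A (s y) (aeval A r x) := fun r => by
      conv_lhs => rw [← hs y]
      rw [← Module.End.mul_apply, ← Module.End.mul_apply, ← map_mul, ← map_mul, mul_comm]
    rw [key, key, h]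
  let Φ : V →ₗ[𝕜] (V →L[𝕜] V) :=
    (LinearMap.toContinuousLinearMap.toLinearMap.comp (aeval A).toLinearMap).comp s
  have hΦ : ∀ y, ((Φ y : V →L[𝕜] V) : V →ₗ[𝕜] V) = aeval A (s y) := fun y => by
    ext; rfl
  have hΦ' : ∀ y (q : 𝕜[X]), aeval A q x = y → (Φ y).det = LinearMap.det (aeval A q) := by
    intro y q h
    rw [ContinuousLinearMap.det, hΦ, huniq (s y) q ((hs y).trans h.symm)]
  have hcont : Continuous fun y => ‖(Φ y).det‖ :=
    (ContinuousLinearMap.continuous_det.comp Φ.continuous_of_finiteDimensional).norm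
  have hpow : ∀ n : ℕ, ‖(Φ ((A ^ n) x)).det‖ = ‖LinearMap.det A‖ ^ n := fun n => by
    rw [hΦ' _ (Polynomial.X ^ n) (by simp)]
    simp
  have hsmul : ∀ c : 𝕜, ‖(Φ (c • x)).det‖ = ‖c‖ ^ Module.finrank 𝕜 V := fun c => by
    rw [hΦ' _ (Polynomial.C c) (by simp), aeval_C, Algebra.algebraMap_eq_smul_one,
      LinearMap.det_smul]
    simp
  obtain ⟨u, v, hu, huv, huvn⟩ :=
    exists_Ioo_forall_pow_notMem (norm_nonneg (LinearMap.det A)) zero_le_one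
  obtain ⟨w, hw⟩ := exists_between huv
  have hN : Module.finrank 𝕜 V ≠ 0 := Module.finrank_pos.ne'
  obtain ⟨_, hy, n, rfl⟩ := hd.inter_open_nonempty ((fun y => ‖(Φ y).det‖) ⁻¹' Ioo u v)
    (isOpen_Ioo.preimage hcont) ⟨((w ^ ((Module.finrank 𝕜 V : ℝ)⁻¹) : ℝ) : 𝕜) • x, by
      have hw0 : 0 ≤ w := (hu.trans hw.1).le
      rw [mem_preimage, hsmul, RCLike.norm_ofReal, abs_of_nonneg (by positivity),
        Real.rpow_inv_natCast_pow hw0 hN]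
      exact hw⟩
  rw [mem_preimage, hpow] at hy
  exact huvn n (by simpa using hy)

/-- Nonzero polynomials in a hypercyclic operator have dense range. -/
theorem IsHypercyclic.denseRange_aeval {T : X →L[𝕜] X} (hT : IsHypercyclic T) {p : 𝕜[X]}
    (hp : p ≠ 0) : DenseRange (aeval T p : X →L[𝕜] X) := by
  obtain ⟨x, hx⟩ := hT
  let M : Submodule 𝕜 X := (LinearMap.range (aeval T p : X →L[𝕜] X).toLinearMap).topologicalClosure
  have hMc : IsClosed (M : Set X) := Submodule.isClosed_topologicalClosure _
  have hpM : ∀ y, aeval T p y ∈ M := fun y => Submodule.le_topologicalClosure _ ⟨y, rfl⟩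
  by_contra hdense
  have hMtop : M ≠ ⊤ := fun h => hdense <| by
    have := Submodule.dense_iff_topologicalClosure_eq_top.mpr h
    rwa [LinearMap.coe_range] at this
  have hTM : M ≤ M.comap T.toLinearMap := by
    refine Submodule.topologicalClosure_minimal _ ?_ (hMc.preimage T.continuous)
    rintro _ ⟨y, rfl⟩
    have := aeval_comm_apply T Polynomial.X p y
    simp only [aeval_X] at this
    simpa [this] using hpM (T y)
  have : IsClosed (M : Set X) := hMc
  have : Nontrivial (X ⧸ M) := Submodule.Quotient.nontrivial_iff.mpr hMtop
  let A : (X ⧸ M) →ₗ[𝕜] (X ⧸ M) := M.mapQ M T.toLinearMap hTM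
  have hpow : ∀ n : ℕ, (A ^ n) (M.mkQ x) = M.mkQ ((T ^ n) x) := fun n => by
    induction n with
    | zero => rfl
    | succ n ih =>
      rw [pow_succ', pow_succ', Module.End.mul_apply, ih]
      rfl
  have hdA : Dense (range fun n : ℕ => (A ^ n) (M.mkQ x)) := by
    have := (M.mkQ_surjective.denseRange).dense_image (f := M.mkQ) continuous_quot_mk hx
    rwa [orbit, ← range_comp, show (⇑M.mkQ ∘ fun n : ℕ => (T ^ n) x) = fun n : ℕ =>
      (A ^ n) (M.mkQ x) from funext fun n => (hpow n).symm] at this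
  -- `p(T)` vanishes modulo `M`, so reducing `X ^ n` modulo `p` puts the dense quotient orbit in a
  -- finite-dimensional subspace.
  let ev : 𝕜[X] →ₗ[𝕜] (X ⧸ M) := M.mkQ.comp
    ((ContinuousLinearMap.apply 𝕜 X x).toLinearMap.comp (aeval T).toLinearMap)
  have hev : ∀ q, ev q = M.mkQ (aeval T q x) := fun q => rfl
  let W : Submodule 𝕜 (X ⧸ M) := (degreeLT 𝕜 p.natDegree).map ev
  have : FiniteDimensional 𝕜 (degreeLT 𝕜 p.natDegree) :=
    (degreeLTEquiv 𝕜 p.natDegree).symm.finiteDimensional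
  have hW : W = ⊤ := by
    rw [← Submodule.dense_iff_topologicalClosure_eq_top.mp
      (hdA.mono (s₂ := (W : Set (X ⧸ M))) ?_)]
    · exact (Submodule.closed_of_finiteDimensional _).submodule_topologicalClosure_eq.symm
    · rintro _ ⟨n, rfl⟩
      refine ⟨Polynomial.X ^ n % p, ?_, ?_⟩
      · rw [SetLike.mem_coe, mem_degreeLT]
        exact (EuclideanDomain.mod_lt _ hp).trans_le degree_le_natDegree
      · dsimp only
        rw [hpow, hev, Submodule.mkQ_apply, Submodule.mkQ_apply, eq_comm, Submodule.Quotient.eq]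
        have h := congrArg (fun q : 𝕜[X] => aeval T q x) (EuclideanDomain.div_add_mod (Polynomial.X ^ n) p)
        simp only [map_add, map_mul, add_apply, mul_apply_eq_comp,
          map_pow, aeval_X] at h
        rw [← h, add_sub_cancel_right]
        exact hpM _
  have : FiniteDimensional 𝕜 (X ⧸ M) := by
    have hWf : FiniteDimensional 𝕜 W := inferInstance
    rw [hW] at hWf
    exact Module.finite_def.mpr (Submodule.fg_top _ |>.mp hWf.fg_top)
  exact not_dense_range_pow_apply_of_finiteDimensional A _ hdA

end Polynomials

/-! ### Transitivity and cyclicity of `T ⊕ T`. -/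

section Transitivity

variable {𝕜 : Type*} [RCLike 𝕜] {X : Type*} [NormedAddCommGroup X] [NormedSpace 𝕜 X]

theorem nontrivial_of_not_finiteDimensional (hX : ¬ FiniteDimensional 𝕜 X) : Nontrivial X := by
  by_contra h
  rw [not_nontrivial_iff_subsingleton] at h
  exact hX inferInstance

/-- The iterates of a hypercyclic vector are hypercyclic. -/
theorem dense_orbit_pow_apply [Nontrivial X] {T : X →L[𝕜] X} {x : X} (hx : Dense (orbit T x))
    (m : ℕ) : Dense (orbit T ((T ^ m) x)) := by
  have : ∀ y : X, (nhdsWithin y {y}ᶜ).NeBot := fun y => Module.punctured_nhds_neBot 𝕜 X y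
  refine (hx.sdiff_finite ((finite_Iio m).image fun n => (T ^ n) x)).mono ?_
  -- Without isolated points, deleting the first `m` iterates preserves density.
  rintro _ ⟨⟨n, rfl⟩, hn⟩
  have hmn : m ≤ n := by
    by_contra h
    exact hn ⟨n, not_le.mp h, rfl⟩
  refine ⟨n - m, ?_⟩
  dsimp only
  rw [← mul_apply_eq_comp, ← pow_add, Nat.sub_add_cancel hmn]

theorem IsHypercyclic.exists_mem_pow_mem [Nontrivial X] {T : X →L[𝕜] X} (hT : IsHypercyclic T)
    {U V : Set X} (hU : IsOpen U) (hU' : U.Nonempty) (hV : IsOpen V) (hV' : V.Nonempty) :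
    ∃ n : ℕ, ∃ x ∈ U, (T ^ n) x ∈ V := by
  obtain ⟨x, hx⟩ := hT
  obtain ⟨_, hm, m, rfl⟩ := hx.inter_open_nonempty U hU hU'
  obtain ⟨_, hn, n, rfl⟩ := (dense_orbit_pow_apply hx m).inter_open_nonempty V hV hV'
  exact ⟨n, _, hm, hn⟩

theorem IsHypercyclic.separableSpace {T : X →L[𝕜] X} (hT : IsHypercyclic T) :
    TopologicalSpace.SeparableSpace X := by
  obtain ⟨x, hx⟩ := hT
  exact ⟨orbit T x, countable_range _, hx⟩

/-- Birkhoff's transitivity theorem. -/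
theorem isHypercyclic_of_transitive [CompleteSpace X] [TopologicalSpace.SeparableSpace X]
    {T : X →L[𝕜] X} (h : ∀ U V : Set X, IsOpen U → U.Nonempty → IsOpen V → V.Nonempty →
      ∃ n : ℕ, ∃ x ∈ U, (T ^ n) x ∈ V) : IsHypercyclic T := by
  have := UniformSpace.secondCountable_of_separable X
  let B := TopologicalSpace.countableBasis X
  have hB := TopologicalSpace.isBasis_countableBasis X
  have : Countable B := (TopologicalSpace.countable_countableBasis X).to_subtype
  have hd : Dense (⋂ V : B, ⋃ n : ℕ, (T ^ n : X →L[𝕜] X) ⁻¹' (V : Set X)) := by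
    refine dense_iInter_of_isOpen (fun V => isOpen_iUnion fun n =>
      (hB.isOpen V.2).preimage (T ^ n).continuous) fun V => ?_
    refine dense_iff_inter_open.mpr fun U hU hU' => ?_
    obtain ⟨n, x, hxU, hxV⟩ := h U V hU hU' (hB.isOpen V.2)
      (TopologicalSpace.nonempty_of_mem_countableBasis V.2)
    exact ⟨x, hxU, mem_iUnion.mpr ⟨n, hxV⟩⟩
  obtain ⟨x, hx⟩ := hd.nonempty
  refine ⟨x, hB.dense_iff.mpr fun V hV _ => ?_⟩
  obtain ⟨n, hn⟩ := mem_iUnion.mp (mem_iInter.mp hx ⟨V, hV⟩)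
  exact ⟨_, hn, n, rfl⟩

/-- If `T` is hypercyclic and `T ⊕ T` is cyclic then `T ⊕ T` is hypercyclic. -/
theorem IsHypercyclic.prodMap_self_of_isCyclic [CompleteSpace X] [Nontrivial X] {T : X →L[𝕜] X}
    (hT : IsHypercyclic T) (hc : IsCyclic (T.prodMap T)) : IsHypercyclic (T.prodMap T) := by
  obtain ⟨⟨a, b⟩, hab⟩ := hc
  have := hT.separableSpace
  -- Dense range of `q(T)` makes `(q(T) a, q(T) b)` cyclic again.
  have hrange : ∀ q : 𝕜[X], q ≠ 0 →
      Dense {z : X × X | ∃ p : 𝕜[X], z = (aeval T p (aeval T q a), aeval T p (aeval T q b))} := by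
    intro q hq
    have hdr : DenseRange (Prod.map (aeval T q : X →L[𝕜] X) (aeval T q : X →L[𝕜] X)) :=
      (hT.denseRange_aeval hq).prodMap (hT.denseRange_aeval hq)
    refine (hdr.dense_image (by fun_prop) hab).mono ?_
    rintro _ ⟨z, hz, rfl⟩
    obtain ⟨p, rfl⟩ := (mem_span_orbit_iff _ _ _).mp hz
    refine ⟨p, ?_⟩
    rw [aeval_prodMap_self, Prod.map_apply, aeval_comm_apply T q p, aeval_comm_apply T q p]
  have : ∀ y : X × X, (nhdsWithin y {y}ᶜ).NeBot :=
    fun y => Module.punctured_nhds_neBot 𝕜 (X × X) y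
  /- Any two pairs of nonempty open sets are linked by a common polynomial in `T`. -/
  have hlink : ∀ U₁ V₁ U₂ V₂ : Set X, IsOpen U₁ → U₁.Nonempty → IsOpen V₁ → V₁.Nonempty →
      IsOpen U₂ → U₂.Nonempty → IsOpen V₂ → V₂.Nonempty →
      ∃ p : 𝕜[X], ∃ u ∈ U₁, ∃ v ∈ V₁, aeval T p u ∈ U₂ ∧ aeval T p v ∈ V₂ := by
    intro U₁ V₁ U₂ V₂ hU₁ hU₁' hV₁ hV₁' hU₂ hU₂' hV₂ hV₂'
    obtain ⟨z, hzU, hz, hz0⟩ := (hab.sdiff_singleton (0 : X × X)).inter_open_nonempty (U₁ ×ˢ V₁)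
      (hU₁.prod hV₁) (hU₁'.prod hV₁')
    obtain ⟨q, rfl⟩ := (mem_span_orbit_iff _ _ _).mp hz
    have hq : q ≠ 0 := by
      rintro rfl
      simp at hz0
    rw [aeval_prodMap_self] at hzU
    obtain ⟨_, hw, p, rfl⟩ := (hrange q hq).inter_open_nonempty (U₂ ×ˢ V₂) (hU₂.prod hV₂)
      (hU₂'.prod hV₂')
    exact ⟨p, _, hzU.1, _, hzU.2, hw.1, hw.2⟩
  refine isHypercyclic_of_transitive fun U V hU hU' hV hV' => ?_
  obtain ⟨⟨u₁, u₂⟩, hu⟩ := hU'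
  obtain ⟨⟨v₁, v₂⟩, hv⟩ := hV'
  obtain ⟨U₁, U₂, hU₁, hU₂, hu₁, hu₂, hUU⟩ := isOpen_prod_iff.mp hU u₁ u₂ hu
  obtain ⟨V₁, V₂, hV₁, hV₂, hv₁, hv₂, hVV⟩ := isOpen_prod_iff.mp hV v₁ v₂ hv
  obtain ⟨p, u, huU, v, hvV, hpu, hpv⟩ := hlink U₁ V₁ U₂ V₂ hU₁ ⟨_, hu₁⟩ hV₁ ⟨_, hv₁⟩ hU₂
    ⟨_, hu₂⟩ hV₂ ⟨_, hv₂⟩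
  obtain ⟨n, x, hxU, hxV⟩ := hT.exists_mem_pow_mem
    (hU₁.inter (hU₂.preimage (aeval T p : X →L[𝕜] X).continuous)) ⟨u, huU, hpu⟩
    (hV₁.inter (hV₂.preimage (aeval T p : X →L[𝕜] X).continuous)) ⟨v, hvV, hpv⟩
  -- `p(T)` commutes with `T ^ n`, so controlling `x` and `T ^ n x` controls the second coordinate
  -- too.
  refine ⟨n, (x, aeval T p x), hUU ⟨hxU.1, hxU.2⟩, hVV ?_⟩
  have h := aeval_prodMap_self T (Polynomial.X ^ n) x (aeval T p x)
  rw [aeval_comm_apply T (Polynomial.X ^ n) p] at h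
  simp only [map_pow, aeval_X] at h
  rw [h]
  exact ⟨hxV.1, hxV.2⟩

end Transitivity

/-! ### Weakly dense orbits. -/

section Weak

variable {𝕜 : Type*} [RCLike 𝕜] {X : Type*} [NormedAddCommGroup X] [NormedSpace 𝕜 X]

/-- Mazur's theorem: norm and weak closures of a convex set agree. -/
theorem isClosed_toWeakSpace_image_topologicalClosure (P : Submodule 𝕜 X) :
    IsClosed (toWeakSpace 𝕜 X '' (P.topologicalClosure : Set X)) := by
  let : NormedSpace ℝ X := NormedSpace.restrictScalars ℝ 𝕜 X
  have : IsScalarTower ℝ 𝕜 X := RestrictScalars.isScalarTower ℝ 𝕜 X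
  have hconv : Convex ℝ (P : Set X) := (P.restrictScalars ℝ).convex
  rw [Submodule.topologicalClosure_coe, hconv.toWeakSpace_closure 𝕜]
  exact isClosed_closure

theorem eq_top_or_eq_top_of_forall_mem_or_mem {R M : Type*} [Ring R] [AddCommGroup M] [Module R M]
    {P Q : Submodule R M} (h : ∀ v, v ∈ P ∨ v ∈ Q) : P = ⊤ ∨ Q = ⊤ := by
  by_contra! hPQ
  obtain ⟨v, hv⟩ := SetLike.exists_not_mem_of_ne_top P hPQ.1 rfl
  obtain ⟨w, hw⟩ := SetLike.exists_not_mem_of_ne_top Q hPQ.2 rfl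
  have hvQ := (h v).resolve_left hv
  have hwP := (h w).resolve_right hw
  rcases h (v + w) with h | h
  · exact hv ((P.add_mem_iff_left hwP).mp h)
  · exact hw ((Q.add_mem_iff_right hvQ).mp h)

/-- The square of a weakly hypercyclic operator is cyclic: the closed linear spans of the even and
the odd part of a weakly dense orbit cover the space, so one of them is everything. -/
theorem IsWeaklyHypercyclic.isCyclic_sq {S : X →L[𝕜] X} (hS : IsWeaklyHypercyclic S) :
    IsCyclic (S ^ 2) := by
  obtain ⟨x, hx⟩ := hS
  let P (y : X) : Submodule 𝕜 X := (Submodule.span 𝕜 (orbit (S ^ 2) y)).topologicalClosure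
  have hP : ∀ (y : X) (k : ℕ), (S ^ (2 * k)) y ∈ P y := fun y k =>
    Submodule.le_topologicalClosure _ (Submodule.subset_span ⟨k, by simp [pow_mul]⟩)
  have hcover : ∀ v, v ∈ P x ∨ v ∈ P (S x) := by
    have hcl := (isClosed_toWeakSpace_image_topologicalClosure
      (Submodule.span 𝕜 (orbit (S ^ 2) x))).union (isClosed_toWeakSpace_image_topologicalClosure
      (Submodule.span 𝕜 (orbit (S ^ 2) (S x))))
    have huniv := (hx.mono (s₂ := toWeakSpace 𝕜 X '' (P x) ∪ toWeakSpace 𝕜 X '' (P (S x))) (by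
      rintro _ ⟨_, ⟨n, rfl⟩, rfl⟩
      obtain ⟨k, rfl | rfl⟩ := Nat.even_or_odd' n
      · exact Or.inl ⟨_, hP x k, rfl⟩
      · exact Or.inr ⟨_, hP (S x) k, by simp [pow_succ]⟩)).closure_eq
    rw [hcl.closure_eq] at huniv
    intro v
    have hv := huniv.ge (mem_univ (toWeakSpace 𝕜 X v))
    rcases hv with ⟨w, hw, hwv⟩ | ⟨w, hw, hwv⟩
    · exact Or.inl ((toWeakSpace 𝕜 X).injective hwv ▸ hw)
    · exact Or.inr ((toWeakSpace 𝕜 X).injective hwv ▸ hw)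
  rcases eq_top_or_eq_top_of_forall_mem_or_mem hcover with h | h
  · exact ⟨x, Submodule.dense_iff_topologicalClosure_eq_top.mpr h⟩
  · exact ⟨S x, Submodule.dense_iff_topologicalClosure_eq_top.mpr h⟩

end Weak

/-! ### Real functionals on orbits, and convex hulls. -/

section Convex

variable {X : Type*} [NormedAddCommGroup X] [NormedSpace ℝ X]

/-- An eigenvector `h` of the adjoint sends the orbit to a geometric sequence, whose absolute values
miss an interval. -/
theorem not_dense_orbit_of_comp_eq_smul {T : X →L[ℝ] X} {h : X →L[ℝ] ℝ} (hh : h ≠ 0) {c : ℝ}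
    (hc : ∀ v, h (T v) = c * h v) (x : X) : ¬ Dense (orbit T x) := by
  intro hx
  have hpow : ∀ n : ℕ, h ((T ^ n) x) = c ^ n * h x := fun n => by
    induction n with
    | zero => simp
    | succ n ih => rw [pow_succ', mul_apply_eq_comp, hc, ih, pow_succ']; ring
  obtain ⟨u, v, hu, huv, hn⟩ := exists_Ioo_forall_pow_notMem (abs_nonneg c) (abs_nonneg (h x))
  obtain ⟨w, hw⟩ := exists_between huv
  obtain ⟨z, hz⟩ := h.toLinearMap.surjective (fun h0 => hh (ContinuousLinearMap.coe_injective h0)) w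
  obtain ⟨_, hy, n, rfl⟩ := hx.inter_open_nonempty ((fun y => |h y|) ⁻¹' Ioo u v)
    (isOpen_Ioo.preimage h.continuous.abs) ⟨z, by
      have : h z = w := hz
      rw [mem_preimage, this, abs_of_pos (hu.trans hw.1)]
      exact hw⟩
  rw [mem_preimage, hpow, abs_mul, abs_pow] at hy
  exact hn n hy

/-- If a real functional `k` is nonpositive wherever `h` is positive then `k` is a multiple
of `h`. -/
theorem exists_eq_mul_of_pos_imp_nonpos {h k : X →ₗ[ℝ] ℝ} (hh : h ≠ 0)
    (hk : ∀ v, 0 < h v → k v ≤ 0) : ∃ c : ℝ, ∀ v, k v = c * h v := by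
  obtain ⟨w, hw⟩ := h.surjective hh 1
  have hker : ∀ v, h v = 0 → k v ≤ 0 := fun v hv => by
    by_contra! hpos
    -- The coefficient makes `k` equal to `1` at a point where `h` is `1`.
    have h1 := hk (w + ((1 - k w) / k v) • v) (by simp [hv, hw])
    simp only [map_add, map_smul, smul_eq_mul] at h1
    rw [div_mul_cancel₀ _ hpos.ne'] at h1
    linarith
  refine ⟨k w, fun v => ?_⟩
  have h1 := hker (v - h v • w) (by simp [hw])
  have h2 := hker (-(v - h v • w)) (by simp [hw])
  simp only [map_neg, map_sub, map_smul, smul_eq_mul] at h1 h2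
  linarith

/-- A nonzero real functional is unbounded above on the even part of a dense orbit. -/
theorem exists_lt_apply_pow_even [Nontrivial X] {T : X →L[ℝ] X} {x : X} (hx : Dense (orbit T x))
    {h : X →L[ℝ] ℝ} (hh : h ≠ 0) (C : ℝ) : ∃ k : ℕ, C < h ((T ^ (2 * k)) x) := by
  by_contra! hC
  let E : Set X := closure (range fun k : ℕ => (T ^ (2 * k)) x)
  let O : Set X := closure (range fun k : ℕ => (T ^ (2 * k + 1)) x)
  have hE : ∀ v ∈ E, h v ≤ C := fun v hv =>
    closure_minimal (t := {v | h v ≤ C}) (by rintro _ ⟨k, rfl⟩; exact hC k)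
      (isClosed_le h.continuous continuous_const) hv
  have hOE : ∀ v ∈ O, T v ∈ E := fun v hv =>
    closure_minimal (t := T ⁻¹' E) (by
      rintro _ ⟨k, rfl⟩
      refine subset_closure ⟨k + 1, ?_⟩
      dsimp only
      rw [show 2 * (k + 1) = (2 * k + 1) + 1 by ring, pow_succ' T (2 * k + 1),
        mul_apply_eq_comp]) (isClosed_closure.preimage T.continuous) hv
  have hEO : ∀ v, v ∈ E ∨ v ∈ O := fun v => by
    have : v ∈ closure (orbit T x) := hx v
    rw [← mem_union, ← closure_union]
    refine closure_mono ?_ this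
    rintro _ ⟨n, rfl⟩
    obtain ⟨k, rfl | rfl⟩ := Nat.even_or_odd' n
    · exact Or.inl ⟨k, rfl⟩
    · exact Or.inr ⟨k, rfl⟩
  -- Such a `v` is a limit of odd iterates, so `T v` is a limit of even ones. Scaling `v` up then
  -- shows that `h v` and `h (T v)` are never both positive, whence `h ∘ T` is a multiple of `h`.
  have hstep : ∀ v, C < h v → h (T v) ≤ C := fun v hv =>
    hE _ (hOE _ ((hEO v).resolve_left fun hvE => (hE v hvE).not_gt hv))
  obtain ⟨c, hc⟩ := exists_eq_mul_of_pos_imp_nonpos (h := h.toLinearMap)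
    (k := h.toLinearMap.comp T.toLinearMap) (fun h0 => hh (ContinuousLinearMap.coe_injective h0)) (by
      intro v hv
      change 0 < h v at hv
      change h (T v) ≤ 0
      by_contra! hpos
      obtain ⟨t, ht⟩ : ∃ t : ℝ, C < t * h v ∧ C < t * h (T v) := by
        have hm : 0 < min (h v) (h (T v)) := lt_min hv hpos
        have ht : 0 ≤ (|C| + 1) / min (h v) (h (T v)) := by positivity
        have hC' : C < (|C| + 1) / min (h v) (h (T v)) * min (h v) (h (T v)) := by
          rw [div_mul_cancel₀ _ hm.ne']
          linarith [le_abs_self C]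
        exact ⟨_, hC'.trans_le (mul_le_mul_of_nonneg_left (min_le_left _ _) ht),
          hC'.trans_le (mul_le_mul_of_nonneg_left (min_le_right _ _) ht)⟩
      have := hstep (t • v) (by simpa using ht.1)
      simp only [map_smul, smul_eq_mul] at this
      linarith [ht.2])
  exact not_dense_orbit_of_comp_eq_smul hh hc x hx

theorem prodMap_neg_pow_even (T : X →L[ℝ] X) (u v : X) (k : ℕ) :
    ((T.prodMap (-T)) ^ (2 * k)) (u, v) = ((T ^ (2 * k)) u, (T ^ (2 * k)) v) := by
  have : ∀ n : ℕ, ((T.prodMap (-T)) ^ n) (u, v) = ((T ^ n) u, ((-T) ^ n) v) := fun n => by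
    induction n with
    | zero => rfl
    | succ n ih => simp [pow_succ', ih]
  rw [this, (even_two_mul k).neg_pow]

/-- If `x` is hypercyclic for `T`, the orbit of `(x, x)` under `T ⊕ (-T)` has dense convex hull. -/
theorem dense_convexHull_orbit_prodMap_neg [Nontrivial X] {T : X →L[ℝ] X} {x : X}
    (hx : Dense (orbit T x)) : Dense (convexHull ℝ (orbit (T.prodMap (-T)) (x, x))) := by
  by_contra hd
  obtain ⟨z, hz⟩ : ∃ z, z ∉ closure (convexHull ℝ (orbit (T.prodMap (-T)) (x, x))) := by
    simpa [Dense] using hd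
  obtain ⟨l, C, hl, hlz⟩ := geometric_hahn_banach_closed_point
    (convex_convexHull ℝ _).closure isClosed_closure hz
  have hlC : ∀ n : ℕ, l (((T.prodMap (-T)) ^ n) (x, x)) < C := fun n =>
    hl _ (subset_closure (subset_convexHull ℝ _ ⟨n, rfl⟩))
  have hsplit : ∀ u v : X, l (u, v) = l.comp (.inl ℝ X X) u + l.comp (.inr ℝ X X) v := fun u v => by
    simp [← map_add]
  have hl0 : l ≠ 0 := by
    rintro rfl
    have := hlC 0
    simp at this hlz
    linarith
  -- With `l = (l₁, l₂)`, even iterates test `l₁ + l₂` along the orbit of `x`. If that sum is zero,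
  -- odd iterates test `l₁ - l₂ = 2 l₁` along the orbit of `T x`.
  by_cases hsum : l.comp (.inl ℝ X X) + l.comp (.inr ℝ X X) = 0
  · have hr : l.comp (.inr ℝ X X) = - l.comp (.inl ℝ X X) := (neg_eq_of_add_eq_zero_right hsum).symm
    have hdiff : (2 : ℝ) • l.comp (.inl ℝ X X) ≠ 0 := by
      intro h
      have h' : l.comp (.inl ℝ X X) = 0 := by simpa using h
      refine hl0 (ContinuousLinearMap.ext fun ⟨u, v⟩ => ?_)
      rw [hsplit, hr, h']
      simp
    obtain ⟨k, hk⟩ := exists_lt_apply_pow_even (dense_orbit_pow_apply hx 1) hdiff C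
    have := hlC (2 * k + 1)
    rw [pow_succ, mul_apply_eq_comp,
      show T.prodMap (-T) (x, x) = (T x, -T x) from rfl, prodMap_neg_pow_even, hsplit, hr] at this
    simp only [neg_apply, map_neg, neg_neg] at this
    simp only [smul_apply, smul_eq_mul, pow_one] at hk
    linarith
  · obtain ⟨k, hk⟩ := exists_lt_apply_pow_even hx hsum C
    have := hlC (2 * k)
    rw [prodMap_neg_pow_even, hsplit] at this
    exact lt_asymm this hk

end Convex

/-! ### Transfer to real or complex scalars, and the square of `T ⊕ -T`. -/

section Complexification

variable {𝕜 : Type*} [RCLike 𝕜] {X : Type*} [NormedAddCommGroup X] [NormedSpace 𝕜 X]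

theorem IsHypercyclic.isConvexCyclic_prodMap_neg [Nontrivial X] {T : X →L[𝕜] X}
    (hT : IsHypercyclic T) : IsConvexCyclic (T.prodMap (-T)) := by
  obtain ⟨x, hx⟩ := hT
  let : NormedSpace ℝ X := NormedSpace.restrictScalars ℝ 𝕜 X
  have : IsScalarTower ℝ 𝕜 X := RestrictScalars.isScalarTower ℝ 𝕜 X
  let R : X →L[ℝ] X := T.restrictScalars ℝ
  have hR : ∀ (n : ℕ) (y : X), (R ^ n) y = (T ^ n) y := fun n y => by
    induction n with
    | zero => rfl
    | succ n ih => rw [pow_succ', pow_succ', mul_apply_eq_comp, ih]; rfl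
  have hRR : ∀ (n : ℕ) (y : X × X), ((R.prodMap (-R)) ^ n) y = ((T.prodMap (-T)) ^ n) y :=
    fun n y => by
      induction n with
      | zero => rfl
      | succ n ih => rw [pow_succ', pow_succ', mul_apply_eq_comp, ih]; rfl
  have hxR : Dense (orbit R x) := by
    simpa only [orbit, hR] using hx
  have key := dense_convexHull_orbit_prodMap_neg hxR
  simp only [orbit, hRR] at key
  exact ⟨(x, x), key⟩

theorem isCyclic_prodMap_self_of_isCyclic_prodMap_neg_sq {T : X →L[𝕜] X}
    (h : IsCyclic ((T.prodMap (-T)) ^ 2)) : IsCyclic (T.prodMap T) := by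
  have hsq : (T.prodMap (-T)) ^ 2 = (T.prodMap T) ^ 2 := by
    ext <;> simp [pow_two]
  obtain ⟨z, hz⟩ := h
  refine ⟨z, hz.mono (Submodule.span_mono ?_)⟩
  rintro _ ⟨n, rfl⟩
  exact ⟨2 * n, by simp [hsq, pow_mul]⟩

end Complexification

end LinearDynamics

/-- `T.prodMap S` is the direct sum `T ⊕ S` acting on `X × X`. -/
theorem corollary3p1 {𝕜 : Type*} [RCLike 𝕜] {X : Type*} [NormedAddCommGroup X] [NormedSpace 𝕜 X]
    [CompleteSpace X] (hX : ¬ FiniteDimensional 𝕜 X) (T : X →L[𝕜] X)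
    (hT : LinearDynamics.IsHypercyclic T)
    (hTT : ¬ LinearDynamics.IsHypercyclic (T.prodMap T)) :
    LinearDynamics.IsConvexCyclic (T.prodMap (-T)) ∧
      ¬ LinearDynamics.IsWeaklyHypercyclic (T.prodMap (-T)) ∧
      ¬ LinearDynamics.IsCyclic ((T.prodMap (-T)) ^ 2) := by
  have := LinearDynamics.nontrivial_of_not_finiteDimensional hX
  have hc : ¬ LinearDynamics.IsCyclic ((T.prodMap (-T)) ^ 2) := fun h => hTT
    (hT.prodMap_self_of_isCyclic
      (LinearDynamics.isCyclic_prodMap_self_of_isCyclic_prodMap_neg_sq h))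
  exact ⟨hT.isConvexCyclic_prodMap_neg, fun h => hc h.isCyclic_sq, hc⟩
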